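/- Let $M$ be $S^1=\mathbb R/2\pi\mathbb Z$ or $\mathbb R$, and let $\mathfrak X$ be $C^\infty(S^1,\mathbb R)$, respectively $C_c^\infty(\mathbb R,\mathbb R)$, viewed as vector fields $h\,\partial_x$. The Virasoro Lie algebra is $\mathfrak g=\mathfrak X\times\mathbb R$ with $$\Big[\tbinom{h}{a},\tbinom{k}{b}\Big]=\tbinom{h'k-hk'}{\omega(h,k)},\qquad \omega(h,k)=\int_M h'k''\,dx,\qquad \Big\langle \tbinom{h}{a},\tbinom{k}{b}\Big\rangle=\int_M hk\,dx+ab .$$ Let $\operatorname{ad}(X)^\top$ be the adjoint of $\operatorname{ad}(X)=[X,\cdot]$ with respect to this inner product, and $\alpha(X)Y=\operatorname{ad}(Y)^\top X$. Let $I\subseteq\mathbb R$ be an interval with more than one point. A curve $U=\binom ua:I\to\mathfrak g$ is smooth if $u(t,x)$ is smooth on $I\times M$ and $a(t)$ is smooth on $I$, where for $M=\mathbb R$ the supports of $u(t,\cdot)$ are required to lie in a common compact set locally uniformly in $t$. In right trivialization, the velocity fields of geodesics of the right invariant $L^2$ metric (for $M=S^1$, on the Virasoro-Bott group) are the smooth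 solutions of $U_t=-\operatorname{ad}(U)^\top U$, and a Jacobi field along the geodesic with velocity field $U$ is a smooth curve $Y=\binom yb:I\to\mathfrak g$ with $$Y_{tt}=[\operatorname{ad}(Y)^\top+\operatorname{ad}(Y),\operatorname{ad}(U)^\top]U-\operatorname{ad}(U)^\top Y_t-\alpha(U)Y_t+\operatorname{ad}(U)Y_t .$$ Let $U=\binom ua$ and $Y=\binom yb$ be smooth curves in $\mathfrak g$. Then: (i) $U$ is the velocity field of a geodesic if and only if $a$ is constant and $u_t=-3u_xu-au_{xxx}$ (the Korteweg-de Vries equation). (ii) Let $U$ be the velocity field of a geodesic. Then $Y$ is a Jacobi field along it if and only if $$\begin{aligned} y_{tt}&=-u(4y_{tx}+3uy_{xx}+ay_{xxxx})-u_x(2y_t+2ay_{xxx})-u_{xxx}(b_t+\omega(y,u)-3ay_x)-ay_{txxx},\quad&(1)\\ b_{tt}&=\omega(u,y_t)+\omega(y,3u_xu)+\omega(y,au_{xxx}),&(2)\end{aligned}$$ and (2) is equivalent (at each $t\in I$) to $b_{tt}=\int_M\big(-y_{txxx}u+y_{xxx}(3u_xu+au_{xxx})\big)dx$. (iii) If $Y$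 is a Jacobi field along the geodesic with velocity field $U$, then there is a constant $B_1$ such that $$b_t+\omega(y,u)=b_t+\int_M y_{xxx}u\,dx=B_1\quad\text{on } I,$$ for every $t_0\in I$ there is a constant $B_0$ with $$b(t)=B_0+B_1t-\int_{t_0}^t\int_M y_{xxx}u\,dx\,ds\qquad(t\in I),\qquad(4)$$ and $y$ satisfies $$y_{tt}=-u(4y_{tx}+3uy_{xx}+ay_{xxxx})-u_x(2y_t+2ay_{xxx})-u_{xxx}(B_1-3ay_x)-ay_{txxx}.\qquad(5)$$ (iv) $U$ is the velocity field of a geodesic and $Y$ is a Jacobi field along it if and only if $a$ is constant, $u_t=-3u_xu-au_{xxx}$, and there is a constant $B_1$ such that (5) holds and $b_t+\int_M y_{xxx}u\,dx=B_1$ on $I$. (v) Conversely, if $u,y$ are smooth curves in $\mathfrak X$ (in the sense above) and $a,B_0,B_1\in\mathbb R$, $t_0\in I$ are such that $u_t=-3u_xu-au_{xxx}$ and (5) hold, then the function $b$ defined by (4) is smooth on $I$ and $\binom yb$ is a Jacobi field along the geodesic with velocity field $\binom ua$. -/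

import Mathlib

open Set Filter Topology MeasureTheory
open scoped ContDiff

namespace VirasoroBott

/-! ### Jacobi equation of a right invariant metric on a Lie group, in right trivialization -/

section RightInvariant

variable {𝔤 : Type*} [LieRing 𝔤]

/-- `ad(X)ᵀ Z`, the adjoint of `ad(X) = [X, ·]` with respect to the inner product `ip`, applied
to `Z`: the vector `W` with `⟨[X, Y], Z⟩ = ⟨Y, W⟩` for all `Y`. (A definite inner product
admits at most one such `W`; the value is unspecified if there is none.) -/
noncomputable def adT (ip : 𝔤 → 𝔤 → ℝ) (X Z : 𝔤) : 𝔤 :=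
  Classical.epsilon fun W => ∀ Y, ip ⁅X, Y⁆ Z = ip Y W

/-- `α(X) Y = ad(Y)ᵀ X`. -/
noncomputable def al (ip : 𝔤 → 𝔤 → ℝ) (X Y : 𝔤) : 𝔤 := adT ip Y X

/-- Right hand side of the Jacobi equation in right trivialization,
`[ad(y)ᵀ + ad(y), ad(u)ᵀ] u - ad(u)ᵀ y_t - α(u) y_t + ad(u) y_t`, with `v = y_t`. -/
noncomputable def jacobiRHS (ip : 𝔤 → 𝔤 → ℝ) (u y v : 𝔤) : 𝔤 :=
  ((adT ip y (adT ip u u) + ⁅y, adT ip u u⁆) - adT ip u (adT ip y u + ⁅y, u⁆))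
    - adT ip u v - al ip u v + ⁅u, v⁆

end RightInvariant

/-! ### Vector fields on the circle and compactly supported vector fields on the line -/

/-- The two one-dimensional base manifolds: `S¹ = ℝ / 2πℤ` and `ℝ`. -/
inductive Base
  | circle
  | line

/-- A set of representatives for the points of the base manifold. -/
def Base.domain : Base → Set ℝ
  | .circle => Ioc 0 (2 * Real.pi)
  | .line => univ

/-- The integral over the base manifold. -/
noncomputable def Base.integral (M : Base) (f : ℝ → ℝ) : ℝ := ∫ x in M.domain, f x

/-- Functions on `S¹` are `2π`-periodic functions; functions on `ℝ` are asked to have compact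
support. -/
def Base.Admissible : Base → (ℝ → ℝ) → Prop
  | .circle, f => Function.Periodic f (2 * Real.pi)
  | .line, f => HasCompactSupport f

/-- `𝔛(S¹)` respectively `𝔛_c(ℝ)`: the smooth admissible coefficient functions `f` of vector
fields `f ∂ₓ`. -/
def Fields (M : Base) : NonUnitalSubalgebra ℝ (ℝ → ℝ) where
  carrier := {f | ContDiff ℝ ∞ f ∧ M.Admissible f}
  add_mem' := by
    rintro f g ⟨hf, hf'⟩ ⟨hg, hg'⟩
    refine ⟨hf.add hg, ?_⟩
    cases M
    · exact Function.Periodic.add hf' hg'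
    · exact HasCompactSupport.add hf' hg'
  zero_mem' := by
    refine ⟨contDiff_const, ?_⟩
    cases M
    · intro x; rfl
    · exact HasCompactSupport.zero
  mul_mem' := by
    rintro f g ⟨hf, hf'⟩ ⟨hg, hg'⟩
    refine ⟨hf.mul hg, ?_⟩
    cases M
    · exact Function.Periodic.mul hf' hg'
    · exact HasCompactSupport.mul_right hf'
  smul_mem' := by
    rintro c f ⟨hf, hf'⟩
    refine ⟨contDiff_const.smul hf, ?_⟩
    cases M
    · intro x; simp [show f (x + 2 * Real.pi) = f x from hf' x]
    · exact HasCompactSupport.smul_left (f := fun _ => c) hf'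

variable {M : Base}

theorem differentiable_fields (f : Fields M) : Differentiable ℝ (f : ℝ → ℝ) :=
  f.2.1.differentiable (by simp)

/-- The derivative `∂ₓ` on vector field coefficients. -/
noncomputable def D (f : Fields M) : Fields M :=
  ⟨deriv (f : ℝ → ℝ), by
    refine ⟨(contDiff_infty_iff_deriv.1 f.2.1).2, ?_⟩
    have h := f.2.2
    cases M
    · intro x
      have h' : (fun z => (f : ℝ → ℝ) (z + 2 * Real.pi)) = (f : ℝ → ℝ) := funext h
      rw [← deriv_comp_add_const, h']
    · exact HasCompactSupport.deriv h⟩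

@[simp] theorem D_apply (f : Fields M) (x : ℝ) : (D f : ℝ → ℝ) x = deriv (f : ℝ → ℝ) x := rfl

theorem D_add (f g : Fields M) : D (f + g) = D f + D g := by
  ext x
  exact deriv_add (differentiable_fields f x) (differentiable_fields g x)

theorem D_sub (f g : Fields M) : D (f - g) = D f - D g := by
  ext x
  exact deriv_sub (differentiable_fields f x) (differentiable_fields g x)

theorem D_smul (c : ℝ) (f : Fields M) : D (c • f) = c • D f := by
  ext x
  exact deriv_const_smul c (differentiable_fields f x)

theorem D_mul (f g : Fields M) : D (f * g) = D f * g + f * D g := by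
  ext x
  exact deriv_mul (differentiable_fields f x) (differentiable_fields g x)

theorem integrable_fields (f : Fields M) :
    Integrable (f : ℝ → ℝ) (volume.restrict M.domain) := by
  have hf := f.2.1.continuous
  have h := f.2.2
  cases M
  · exact hf.integrableOn_Ioc
  · exact (hf.integrable_of_hasCompactSupport h).integrableOn

theorem integral_add (f g : Fields M) :
    M.integral (f + g : Fields M) = M.integral f + M.integral g :=
  MeasureTheory.integral_add (integrable_fields f) (integrable_fields g)

theorem integral_smul (c : ℝ) (f : Fields M) :
    M.integral (c • f : Fields M) = c * M.integral f :=
  MeasureTheory.integral_const_mul c _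

theorem integral_D (f : Fields M) : M.integral (D f) = 0 := by
  have hd : ∀ x, HasDerivAt (f : ℝ → ℝ) ((D f : ℝ → ℝ) x) x :=
    fun x => (differentiable_fields f x).hasDerivAt
  have hc := (D f).2.1.continuous
  have hi := integrable_fields (D f)
  have h := f.2.2
  have hi' := (integrable_fields f)
  cases M
  · change ∫ x in Ioc 0 (2 * Real.pi), (D f : ℝ → ℝ) x = 0
    rw [← intervalIntegral.integral_of_le (by positivity),
      intervalIntegral.integral_eq_sub_of_hasDerivAt (fun x _ => hd x)
        (hc.intervalIntegrable _ _)]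
    have := h 0
    rw [zero_add] at this
    rw [this, sub_self]
  · simp only [Base.integral, Base.domain, Measure.restrict_univ] at hi hi' ⊢
    exact integral_eq_zero_of_hasDerivAt_of_integrable hd hi hi'

/-- The Gelfand-Fuchs cocycle `ω(h, k) = ∫ h' k'' dx`. -/
noncomputable def omega (M : Base) (h k : ℝ → ℝ) : ℝ :=
  M.integral fun x => deriv h x * iteratedDeriv 2 k x

theorem omega_eq (h k : Fields M) : omega M h k = M.integral (D h * D (D k) : Fields M) := by
  unfold omega
  congr 1
  ext x
  rw [iteratedDeriv_succ, iteratedDeriv_one]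
  rfl

/-! ### The Virasoro Lie algebra -/

/-- The central extension `ℝ ×_ω 𝔛` of the vector fields; the pair `(h, a)` is the column vector
with entries `h` and `a`. -/
def Vir (M : Base) : Type := Fields M × ℝ

noncomputable instance : AddCommGroup (Vir M) := inferInstanceAs (AddCommGroup (Fields M × ℝ))

noncomputable instance : Module ℝ (Vir M) := inferInstanceAs (Module ℝ (Fields M × ℝ))

/-- The bracket `[(h, a), (k, b)] = (h' k - h k', ω(h, k))`. -/
noncomputable instance : Bracket (Vir M) (Vir M) where
  bracket X Y := (D X.1 * Y.1 - X.1 * D Y.1, omega M X.1 Y.1)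

theorem bracket_def (X Y : Vir M) :
    ⁅X, Y⁆ = ((D X.1 * Y.1 - X.1 * D Y.1, omega M X.1 Y.1) : Fields M × ℝ) := rfl

theorem omega_add_left (f g k : Fields M) :
    omega M (f + g : Fields M) k = omega M f k + omega M g k := by
  simp only [omega_eq, D_add, add_mul, integral_add]

theorem omega_add_right (f g k : Fields M) :
    omega M f (g + k : Fields M) = omega M f g + omega M f k := by
  simp only [omega_eq, D_add, mul_add, integral_add]

theorem omega_smul_right (c : ℝ) (f g : Fields M) :
    omega M f (c • g : Fields M) = c * omega M f g := by
  simp only [omega_eq, D_smul, mul_smul_comm, integral_smul]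

theorem omega_self (f : Fields M) : omega M f f = 0 := by
  have h1 : D (D f * D f) = (2 : ℝ) • (D f * D (D f)) := by
    rw [D_mul, mul_comm, two_smul]
  have h2 := integral_D (D f * D f)
  rw [h1, integral_smul] at h2
  rw [omega_eq]
  linarith

theorem omega_cocycle (f g k : Fields M) :
    omega M f (D g * k - g * D k : Fields M) =
      omega M (D f * g - f * D g : Fields M) k + omega M g (D f * k - f * D k : Fields M) := by
  have key : D f * D (D (D g * k - g * D k)) = D (D f * g - f * D g) * D (D k)
      + D g * D (D (D f * k - f * D k))
      + D (D f * (D (D g) * k - g * D (D k)) - D g * (D (D f) * k - f * D (D k))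
        ) := by
    simp only [D_mul, D_sub, D_add]
    ext x
    simp only [NonUnitalSubalgebra.coe_add, NonUnitalSubalgebra.coe_mul,
      NonUnitalSubalgebra.coe_sub, Pi.add_apply, Pi.mul_apply, Pi.sub_apply]
    ring
  simp only [omega_eq]
  rw [key, integral_add, integral_add, integral_D, add_zero]

noncomputable instance : LieRing (Vir M) where
  add_lie X Y Z := by
    refine Prod.ext ?_ (omega_add_left X.1 Y.1 Z.1)
    change D (X.1 + Y.1) * Z.1 - (X.1 + Y.1) * D Z.1 =
      (D X.1 * Z.1 - X.1 * D Z.1) + (D Y.1 * Z.1 - Y.1 * D Z.1)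
    rw [D_add, add_mul, add_mul]
    abel
  lie_add X Y Z := by
    refine Prod.ext ?_ (omega_add_right X.1 Y.1 Z.1)
    change D X.1 * (Y.1 + Z.1) - X.1 * D (Y.1 + Z.1) =
      (D X.1 * Y.1 - X.1 * D Y.1) + (D X.1 * Z.1 - X.1 * D Z.1)
    rw [D_add, mul_add, mul_add]
    abel
  lie_self X := by
    refine Prod.ext ?_ (omega_self X.1)
    change D X.1 * X.1 - X.1 * D X.1 = 0
    rw [mul_comm, sub_self]
  leibniz_lie X Y Z := by
    refine Prod.ext ?_ (omega_cocycle X.1 Y.1 Z.1)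
    change D X.1 * (D Y.1 * Z.1 - Y.1 * D Z.1) - X.1 * D (D Y.1 * Z.1 - Y.1 * D Z.1) =
      (D (D X.1 * Y.1 - X.1 * D Y.1) * Z.1 - (D X.1 * Y.1 - X.1 * D Y.1) * D Z.1) +
      (D Y.1 * (D X.1 * Z.1 - X.1 * D Z.1) - Y.1 * D (D X.1 * Z.1 - X.1 * D Z.1))
    simp only [D_mul, D_sub]
    ext x
    simp only [NonUnitalSubalgebra.coe_add, NonUnitalSubalgebra.coe_mul,
      NonUnitalSubalgebra.coe_sub, Pi.add_apply, Pi.mul_apply, Pi.sub_apply]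
    ring

noncomputable instance : LieAlgebra ℝ (Vir M) where
  lie_smul c X Y := by
    refine Prod.ext ?_ (omega_smul_right c X.1 Y.1)
    change D X.1 * (c • Y.1) - X.1 * D (c • Y.1) = c • (D X.1 * Y.1 - X.1 * D Y.1)
    rw [D_smul, mul_smul_comm, mul_smul_comm, smul_sub]

/-- The `L²` inner product `⟨(h, a), (k, b)⟩ = ∫ h k dx + a b`. -/
noncomputable def ip (X Y : Vir M) : ℝ := M.integral (X.1 * Y.1 : Fields M) + X.2 * Y.2

/-! ### Curves, geodesics and Jacobi fields -/

/-- `t ↦ u(t)`, `t ∈ I`, is a smooth curve of vector fields: `u(t, x)` is smooth on `I × ℝ` and,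
on the line, the supports of the `u(t)` lie in a common compact set locally in `t`. -/
structure IsSmoothFamily (I : Set ℝ) (u : ℝ → Fields M) : Prop where
  smooth : ContDiffOn ℝ ∞ (fun p : ℝ × ℝ => (u p.1 : ℝ → ℝ) p.2) (I ×ˢ univ)
  support : M = Base.line → ∀ t ∈ I, ∃ K : Set ℝ, IsCompact K ∧
    ∀ᶠ s in 𝓝[I] t, ∀ x, x ∉ K → (u s : ℝ → ℝ) x = 0

/-- The curve `t ↦ (u(t), a(t))` in the Virasoro Lie algebra. -/
def curve (u : ℝ → Fields M) (a : ℝ → ℝ) : ℝ → Vir M := fun t => (u t, a t)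

/-- `V` is the time derivative of the curve `U` on `I`, both with values in the Virasoro Lie
algebra. (At a boundary point of `I` this is the one-sided derivative.) -/
def IsTimeDeriv (I : Set ℝ) (U V : ℝ → Vir M) : Prop :=
  ∀ t ∈ I, (∀ x, HasDerivWithinAt (fun s => ((U s).1 : ℝ → ℝ) x) (((V t).1 : ℝ → ℝ) x) I t) ∧
    HasDerivWithinAt (fun s => (U s).2) (V t).2 I t

/-- `U` is the right trivialized velocity field of a geodesic: `U_t = - ad(U)ᵀ U`. -/
def IsGeodesicVelocity (I : Set ℝ) (U : ℝ → Vir M) : Prop :=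
  ∃ V : ℝ → Vir M, IsTimeDeriv I U V ∧ ∀ t ∈ I, V t = - adT ip (U t) (U t)

/-- `Y` is a Jacobi field, in right trivialization, along the geodesic with velocity field `U`:
`Y_tt = [ad(Y)ᵀ + ad(Y), ad(U)ᵀ] U - ad(U)ᵀ Y_t - α(U) Y_t + ad(U) Y_t`. -/
def IsJacobiField (I : Set ℝ) (U Y : ℝ → Vir M) : Prop :=
  ∃ V W : ℝ → Vir M, IsTimeDeriv I Y V ∧ IsTimeDeriv I V W ∧
    ∀ t ∈ I, W t = jacobiRHS ip (U t) (Y t) (V t)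

/-! ### The partial differential equations -/

/-- The function `u(t, x)` of a curve of vector fields. -/
def fn (u : ℝ → Fields M) : ℝ → ℝ → ℝ := fun t => (u t : ℝ → ℝ)

/-- The partial derivative `∂ₜ f`, for `t` in the interval `I`. -/
noncomputable def dt (I : Set ℝ) (f : ℝ → ℝ → ℝ) : ℝ → ℝ → ℝ :=
  fun t x => derivWithin (fun s => f s x) I t

/-- The `k`-th partial derivative `∂ₓᵏ f`. -/
noncomputable def dx (k : ℕ) (f : ℝ → ℝ → ℝ) : ℝ → ℝ → ℝ :=
  fun t x => iteratedDeriv k (f t) x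

/-- The Korteweg-de Vries equation `u_t = -3 u_x u - a u_xxx`. -/
def IsKdV (I : Set ℝ) (a : ℝ) (u : ℝ → ℝ → ℝ) : Prop :=
  ∀ t ∈ I, ∀ x, dt I u t x = -3 * dx 1 u t x * u t x - a * dx 3 u t x

/-- The equation
`y_tt = -u (4 y_tx + 3 u y_xx + a y_xxxx) - u_x (2 y_t + 2 a y_xxx) - u_xxx (B - 3 a y_x)
- a y_txxx`, where `a` and `B` may depend on `t`. -/
def JacobiPDE (I : Set ℝ) (a B : ℝ → ℝ) (u y : ℝ → ℝ → ℝ) : Prop :=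
  ∀ t ∈ I, ∀ x, dt I (dt I y) t x =
    - u t x * (4 * dx 1 (dt I y) t x + 3 * u t x * dx 2 y t x + a t * dx 4 y t x)
    - dx 1 u t x * (2 * dt I y t x + 2 * a t * dx 3 y t x)
    - dx 3 u t x * (B t - 3 * a t * dx 1 y t x)
    - a t * dx 3 (dt I y) t x

end VirasoroBott

namespace VirasoroBott

variable {M : Base} {I : Set ℝ}

/-! ### Calculus on intervals and strips -/

/-! Integration by parts on `M` has no boundary terms, so the adjoint is explicit: ad(X)ᵀZ has field
component 2 h' k + h k' + c h''' for X = (h, ·), Z = (k, c), and central component 0 (`adT_eq`).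
Hence the geodesic equation says that `a` is constant and `u` solves KdV. Substituting the adjoint
in the Jacobi equation and expanding by the product rule gives its two components (`fst_jacobiRHS`,
`snd_jacobiRHS`). Along a KdV solution the right side of the central one is -d/dt ω(y, u), because ω
is antisymmetric and u_t = -(3 u_x u + a u_xxx) (`hasDerivWithinAt_omega_of_kdv`). So the central
equation says exactly that b_t + ω(y, u) is a constant B₁. This quantity is also the only way `b`
enters the field component, which therefore closes up to an equation for `y` alone
(`geodesic_and_jacobi_iff`); one more integration recovers `b`. The analysis behind this is calculus
on I × ℝ up to the boundary: mixed partials commute, and time derivatives pass under the integral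
(`hasDerivWithinAt_integral`). -/

theorem convex_and_interior_nonempty (hI : I.OrdConnected) (hI' : I.Nontrivial) :
    Convex ℝ I ∧ (interior I).Nonempty := by
  refine ⟨hI.convex, ?_⟩
  obtain ⟨a, ha, b, hb, hab⟩ := hI'.exists_lt
  exact (nonempty_Ioo.2 hab).mono
    (interior_maximal (Ioo_subset_Icc_self.trans (hI.out ha hb)) isOpen_Ioo)

theorem uniqueDiffOn_interval (hI : I.OrdConnected) (hI' : I.Nontrivial) : UniqueDiffOn ℝ I :=
  uniqueDiffOn_convex (convex_and_interior_nonempty hI hI').1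
    (convex_and_interior_nonempty hI hI').2

theorem uniqueDiffOn_strip (hI : I.OrdConnected) (hI' : I.Nontrivial) :
    UniqueDiffOn ℝ (I ×ˢ (univ : Set ℝ)) :=
  (uniqueDiffOn_interval hI hI').prod uniqueDiffOn_univ

/-- Symmetry of the second derivative within a set needs this at boundary points of the strip. -/
theorem strip_subset_closure_interior (hI : I.OrdConnected) (hI' : I.Nontrivial) :
    I ×ˢ (univ : Set ℝ) ⊆ closure (interior (I ×ˢ (univ : Set ℝ))) := by
  obtain ⟨h1, h2⟩ := convex_and_interior_nonempty hI hI'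
  rw [interior_prod_eq, closure_prod_eq, h1.closure_interior_eq_closure_of_nonempty_interior h2]
  exact prod_mono subset_closure (by simp)

theorem hasDerivWithinAt_slice_fst {g : ℝ × ℝ → ℝ}
    (hg : DifferentiableOn ℝ g (I ×ˢ univ)) {t : ℝ} (ht : t ∈ I) (x : ℝ) :
    HasDerivWithinAt (fun s => g (s, x)) (fderivWithin ℝ g (I ×ˢ univ) (t, x) (1, 0)) I t := by
  have h1 := (hg (t, x) ⟨ht, mem_univ x⟩).hasFDerivWithinAt
  have h2 : HasDerivWithinAt (fun s : ℝ => (s, x)) ((1 : ℝ), (0 : ℝ)) I t :=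
    (hasDerivWithinAt_id t I).prodMk (hasDerivWithinAt_const t I x)
  exact h1.comp_hasDerivWithinAt t h2 (fun s hs => (⟨hs, mem_univ x⟩ : (s, x) ∈ I ×ˢ univ))

theorem hasDerivAt_slice_snd {g : ℝ × ℝ → ℝ}
    (hg : DifferentiableOn ℝ g (I ×ˢ univ)) {t : ℝ} (ht : t ∈ I) (x : ℝ) :
    HasDerivAt (fun z => g (t, z)) (fderivWithin ℝ g (I ×ˢ univ) (t, x) (0, 1)) x := by
  have h1 := (hg (t, x) ⟨ht, mem_univ x⟩).hasFDerivWithinAt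
  have h2 : HasDerivWithinAt (fun z : ℝ => (t, z)) ((0 : ℝ), (1 : ℝ)) univ x :=
    (hasDerivWithinAt_const x univ t).prodMk (hasDerivWithinAt_id x univ)
  exact hasDerivWithinAt_univ.1 (h1.comp_hasDerivWithinAt x h2
    (fun z _ => (⟨ht, mem_univ z⟩ : (t, z) ∈ I ×ˢ univ)))

theorem contDiffOn_fderivWithin_strip (hI : I.OrdConnected) (hI' : I.Nontrivial)
    {g : ℝ × ℝ → ℝ} (hg : ContDiffOn ℝ ∞ g (I ×ˢ univ)) (v : ℝ × ℝ) :
    ContDiffOn ℝ ∞ (fun p => fderivWithin ℝ g (I ×ˢ univ) p v) (I ×ˢ univ) :=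
  (hg.fderivWithin (uniqueDiffOn_strip hI hI') (by simp)).clm_apply contDiffOn_const

/-- Both sides are values of the second derivative within the strip, which is symmetric also over
the endpoints of `I`. -/
theorem fderivWithin_strip_comm (hI : I.OrdConnected) (hI' : I.Nontrivial)
    {g : ℝ × ℝ → ℝ} (hg : ContDiffOn ℝ ∞ g (I ×ˢ univ)) {p : ℝ × ℝ} (hp : p ∈ I ×ˢ (univ : Set ℝ))
    (v w : ℝ × ℝ) :
    fderivWithin ℝ (fun q => fderivWithin ℝ g (I ×ˢ univ) q v) (I ×ˢ univ) p w =
      fderivWithin ℝ (fun q => fderivWithin ℝ g (I ×ˢ univ) q w) (I ×ˢ univ) p v := by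
  have hS := uniqueDiffOn_strip hI hI'
  have hd : DifferentiableWithinAt ℝ (fderivWithin ℝ g (I ×ˢ univ)) (I ×ˢ univ) p :=
    (hg.fderivWithin hS (m := ∞) (by simp)).differentiableOn (by simp) p hp
  have key : ∀ v w : ℝ × ℝ,
      fderivWithin ℝ (fun q => fderivWithin ℝ g (I ×ˢ univ) q v) (I ×ˢ univ) p w =
      fderivWithin ℝ (fderivWithin ℝ g (I ×ˢ univ)) (I ×ˢ univ) p w v := by
    intro v w
    rw [fderivWithin_clm_apply (hS p hp) hd (differentiableWithinAt_const v)]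
    simp
  rw [key, key]
  exact ((hg p hp).isSymmSndFDerivWithinAt
    (by rw [minSmoothness_of_isRCLikeNormedField]; exact WithTop.coe_le_coe.2 le_top) hS
    (strip_subset_closure_interior hI hI' hp) hp).eq w v

/-- The fundamental theorem of calculus on an interval, with one-sided derivatives at boundary
points. -/
theorem hasDerivWithinAt_integral_of_continuousOn (hI : I.OrdConnected) {F : ℝ → ℝ}
    (hF : ContinuousOn F I) {t₀ t : ℝ} (ht₀ : t₀ ∈ I) (ht : t ∈ I) :
    HasDerivWithinAt (fun s => ∫ r in t₀..s, F r) (F t) I t := by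
  have hint : ∀ {a b : ℝ}, a ∈ I → b ∈ I → IntervalIntegrable F volume a b := fun ha hb =>
    (hF.mono (hI.uIcc_subset ha hb)).intervalIntegrable
  rw [hasDerivWithinAt_iff_isLittleO, Asymptotics.isLittleO_iff]
  intro c hc
  obtain ⟨δ, hδ, H⟩ := Metric.continuousWithinAt_iff.1 (hF t ht) c hc
  filter_upwards [self_mem_nhdsWithin, mem_nhdsWithin_of_mem_nhds (Metric.ball_mem_nhds t hδ)]
    with s hs hsδ
  -- The linearization error is an integral between `t` and `s` of a function bounded by `c`;
  -- order-connectedness keeps the segment inside `I`.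
  have h1 : (∫ r in t₀..s, F r) - (∫ r in t₀..t, F r) - (s - t) • F t =
      ∫ r in t..s, (F r - F t) := by
    rw [intervalIntegral.integral_interval_sub_left (hint ht₀ hs) (hint ht₀ ht),
      intervalIntegral.integral_sub (hint ht hs) intervalIntegrable_const,
      intervalIntegral.integral_const]
  rw [h1]
  refine intervalIntegral.norm_integral_le_of_norm_le_const fun r hr => ?_
  have hr' := uIoc_subset_uIcc hr
  have : dist r t < δ := by
    have := abs_sub_left_of_mem_uIcc hr'
    rw [Real.dist_eq]
    rw [Metric.mem_ball, Real.dist_eq] at hsδ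
    linarith
  exact (H (hI.uIcc_subset ht hs hr') this).le

theorem eq_of_hasDerivWithinAt_zero (hI : I.OrdConnected) {f : ℝ → ℝ}
    (hf : ∀ t ∈ I, HasDerivWithinAt f 0 I t) {s t : ℝ} (hs : s ∈ I) (ht : t ∈ I) : f s = f t := by
  have h := hI.convex.norm_image_sub_le_of_norm_hasDerivWithin_le (C := 0) hf (by simp) ht hs
  rw [zero_mul] at h
  exact sub_eq_zero.1 (norm_le_zero_iff.1 h)

/-! ### Smooth families of vector fields and their time derivatives -/

open Classical in
/-- The time derivative of a curve of vector fields. -/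
noncomputable def timeDeriv (I : Set ℝ) (u : ℝ → Fields M) (t : ℝ) : Fields M :=
  if h : dt I (fn u) t ∈ Fields M then ⟨dt I (fn u) t, h⟩ else 0

theorem dt_eq_fderivWithin (hI : I.OrdConnected) (hI' : I.Nontrivial)
    {u : ℝ → Fields M} (hu : IsSmoothFamily I u) {t : ℝ} (ht : t ∈ I) (x : ℝ) :
    dt I (fn u) t x = fderivWithin ℝ (fun p : ℝ × ℝ => (u p.1 : ℝ → ℝ) p.2) (I ×ˢ univ) (t, x)
      (1, 0) :=
  (hasDerivWithinAt_slice_fst (hu.smooth.differentiableOn (by simp)) ht x).derivWithin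
    (uniqueDiffOn_interval hI hI' t ht)

theorem dt_eq_zero_of_eventually {u : ℝ → Fields M} {K : Set ℝ} {t : ℝ} (ht : t ∈ I)
    (h : ∀ᶠ s in 𝓝[I] t, ∀ x, x ∉ K → (u s : ℝ → ℝ) x = 0) {x : ℝ} (hx : x ∉ K) :
    dt I (fn u) t x = 0 := by
  have h1 : (fun s => fn u s x) =ᶠ[𝓝[I] t] fun _ => 0 := h.mono fun s hs => hs x hx
  unfold dt
  rw [h1.derivWithin_eq (h1.self_of_nhdsWithin ht)]
  simp

/-- Periodicity survives because the functions of time at x and x + 2π coincide; compact support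
survives because one compact set serves all nearby times. Thus `timeDeriv` never takes its default
value on a smooth family. -/
theorem dt_mem_fields (hI : I.OrdConnected) (hI' : I.Nontrivial)
    {u : ℝ → Fields M} (hu : IsSmoothFamily I u) {t : ℝ} (ht : t ∈ I) :
    dt I (fn u) t ∈ Fields M := by
  refine ⟨?_, ?_⟩
  · have h1 := contDiffOn_fderivWithin_strip hI hI' hu.smooth (1, 0)
    have h2 : ContDiff ℝ ∞ (fun x : ℝ => (t, x)) := by fun_prop
    have h3 := h1.comp_contDiff h2 (fun x => ⟨ht, mem_univ x⟩)
    have : dt I (fn u) t = _ := funext fun x => dt_eq_fderivWithin hI hI' hu ht x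
    rw [this]
    exact h3
  · cases M
    · intro x
      have : (fun s => fn u s (x + 2 * Real.pi)) = fun s => fn u s x :=
        funext fun s => (u s).2.2 x
      simp only [dt, this]
    · obtain ⟨K, hK, h⟩ := hu.support rfl t ht
      exact HasCompactSupport.intro hK fun x hx => dt_eq_zero_of_eventually ht h hx

theorem timeDeriv_coe (hI : I.OrdConnected) (hI' : I.Nontrivial)
    {u : ℝ → Fields M} (hu : IsSmoothFamily I u) {t : ℝ} (ht : t ∈ I) :
    (timeDeriv I u t : ℝ → ℝ) = dt I (fn u) t := by
  rw [timeDeriv, dif_pos (dt_mem_fields hI hI' hu ht)]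

theorem hasDerivWithinAt_timeDeriv (hI : I.OrdConnected) (hI' : I.Nontrivial)
    {u : ℝ → Fields M} (hu : IsSmoothFamily I u) {t : ℝ} (ht : t ∈ I) (x : ℝ) :
    HasDerivWithinAt (fun s => (u s : ℝ → ℝ) x) ((timeDeriv I u t : ℝ → ℝ) x) I t := by
  rw [timeDeriv_coe hI hI' hu ht, dt_eq_fderivWithin hI hI' hu ht]
  exact hasDerivWithinAt_slice_fst (hu.smooth.differentiableOn (by simp)) ht x

theorem timeDeriv_eq_of_hasDerivWithinAt (hI : I.OrdConnected) (hI' : I.Nontrivial)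
    {u : ℝ → Fields M} {v : Fields M} {t : ℝ} (ht : t ∈ I)
    (h : ∀ x, HasDerivWithinAt (fun s => (u s : ℝ → ℝ) x) ((v : ℝ → ℝ) x) I t) :
    timeDeriv I u t = v := by
  have h1 : dt I (fn u) t = v :=
    funext fun x => (h x).derivWithin (uniqueDiffOn_interval hI hI' t ht)
  have h2 : dt I (fn u) t ∈ Fields M := h1 ▸ v.2
  rw [timeDeriv, dif_pos h2]
  exact Subtype.ext h1

theorem IsSmoothFamily.timeDeriv (hI : I.OrdConnected) (hI' : I.Nontrivial)
    {u : ℝ → Fields M} (hu : IsSmoothFamily I u) : IsSmoothFamily I (timeDeriv I u) where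
  smooth := (contDiffOn_fderivWithin_strip hI hI' hu.smooth (1, 0)).congr fun p hp => by
    rw [timeDeriv_coe hI hI' hu hp.1, dt_eq_fderivWithin hI hI' hu hp.1]
  support := fun hM t ht => by
    obtain ⟨K, hK, h⟩ := hu.support hM t ht
    refine ⟨K, hK, ?_⟩
    -- At times near `t` the vanishing off `K` again holds in a neighbourhood, so the same `K` works
    -- for the derivative.
    filter_upwards [eventually_eventually_nhdsWithin.2 h, self_mem_nhdsWithin] with s hs hsI x hx
    rw [timeDeriv_coe hI hI' hu hsI]
    exact dt_eq_zero_of_eventually hsI hs hx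

theorem D_eq_fderivWithin {u : ℝ → Fields M} (hu : IsSmoothFamily I u) {t : ℝ} (ht : t ∈ I)
    (x : ℝ) :
    (D (u t) : ℝ → ℝ) x = fderivWithin ℝ (fun p : ℝ × ℝ => (u p.1 : ℝ → ℝ) p.2) (I ×ˢ univ) (t, x)
      (0, 1) :=
  (hasDerivAt_slice_snd (hu.smooth.differentiableOn (by simp)) ht x).deriv

theorem IsSmoothFamily.D (hI : I.OrdConnected) (hI' : I.Nontrivial)
    {u : ℝ → Fields M} (hu : IsSmoothFamily I u) : IsSmoothFamily I fun t => D (u t) where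
  smooth := (contDiffOn_fderivWithin_strip hI hI' hu.smooth (0, 1)).congr fun p hp =>
    D_eq_fderivWithin hu hp.1 p.2
  support := fun hM t ht => by
    obtain ⟨K, hK, h⟩ := hu.support hM t ht
    refine ⟨K, hK, h.mono fun s hs x hx => ?_⟩
    have h1 : (u s : ℝ → ℝ) =ᶠ[𝓝 x] fun _ => 0 := by
      filter_upwards [hK.isClosed.isOpen_compl.mem_nhds hx] with z hz using hs z hz
    rw [D_apply, h1.deriv_eq, deriv_const]

theorem IsSmoothFamily.mul {u v : ℝ → Fields M} (hu : IsSmoothFamily I u)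
    (hv : IsSmoothFamily I v) : IsSmoothFamily I fun t => u t * v t where
  smooth := hu.smooth.mul hv.smooth
  support := fun hM t ht => by
    obtain ⟨K, hK, h⟩ := hu.support hM t ht
    refine ⟨K, hK, h.mono fun s hs x hx => ?_⟩
    simp [hs x hx]

theorem timeDeriv_D (hI : I.OrdConnected) (hI' : I.Nontrivial)
    {u : ℝ → Fields M} (hu : IsSmoothFamily I u) {t : ℝ} (ht : t ∈ I) :
    timeDeriv I (fun s => D (u s)) t = D (timeDeriv I u t) := by
  have hS := uniqueDiffOn_strip hI hI'
  ext x
  have hp : (t, x) ∈ I ×ˢ (univ : Set ℝ) := ⟨ht, mem_univ x⟩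
  rw [timeDeriv_coe hI hI' (hu.D hI hI') ht, dt_eq_fderivWithin hI hI' (hu.D hI hI') ht,
    D_eq_fderivWithin (hu.timeDeriv hI hI') ht,
    fderivWithin_congr (fun p hp => D_eq_fderivWithin hu hp.1 p.2) (D_eq_fderivWithin hu ht x),
    fderivWithin_strip_comm hI hI' hu.smooth hp]
  have hc : EqOn (fun p : ℝ × ℝ => (timeDeriv I u p.1 : ℝ → ℝ) p.2)
      (fun p => fderivWithin ℝ (fun p : ℝ × ℝ => (u p.1 : ℝ → ℝ) p.2) (I ×ˢ univ) p (1, 0))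
      (I ×ˢ univ) := fun p hp => by
    simp only [timeDeriv_coe hI hI' hu hp.1, dt_eq_fderivWithin hI hI' hu hp.1]
  rw [fderivWithin_congr hc (hc hp)]

theorem timeDeriv_mul (hI : I.OrdConnected) (hI' : I.Nontrivial) {u v : ℝ → Fields M}
    (hu : IsSmoothFamily I u) (hv : IsSmoothFamily I v) {t : ℝ} (ht : t ∈ I) :
    timeDeriv I (fun s => u s * v s) t = timeDeriv I u t * v t + u t * timeDeriv I v t :=
  timeDeriv_eq_of_hasDerivWithinAt hI hI' ht fun x =>
    (hasDerivWithinAt_timeDeriv hI hI' hu ht x).mul (hasDerivWithinAt_timeDeriv hI hI' hv ht x)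

/-! ### Differentiation under the integral sign -/

/-- Treats both base manifolds alike in the domination argument: on the circle `K` contains the
whole fundamental domain and the condition is vacuous. -/
theorem IsSmoothFamily.exists_compact {u : ℝ → Fields M} (hu : IsSmoothFamily I u) {t : ℝ}
    (ht : t ∈ I) : ∃ K : Set ℝ, IsCompact K ∧
      ∀ᶠ s in 𝓝[I] t, ∀ x ∈ M.domain, x ∉ K → (u s : ℝ → ℝ) x = 0 := by
  cases M
  · exact ⟨Icc 0 (2 * Real.pi), isCompact_Icc, Eventually.of_forall fun s x hx hxK =>
      (hxK (Ioc_subset_Icc_self hx)).elim⟩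
  · obtain ⟨K, hK, h⟩ := hu.support rfl t ht
    exact ⟨K, hK, h.mono fun s hs x _ => hs x⟩

/-- A tube argument: a bound on the slice {t} × K, increased by 1, holds near each of its points,
and compactness of `K` gives a common neighbourhood of `t`. -/
theorem eventually_norm_le_of_continuousOn_strip {g : ℝ × ℝ → ℝ}
    (hg : ContinuousOn g (I ×ˢ univ)) {K : Set ℝ} (hK : IsCompact K) {t : ℝ} (ht : t ∈ I) :
    ∃ C, ∀ᶠ s in 𝓝 t, ∀ x ∈ K, s ∈ I → ‖g (s, x)‖ ≤ C := by
  have h1 : ContinuousOn (fun x => g (t, x)) K :=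
    hg.comp (by fun_prop) fun x _ => ⟨ht, mem_univ x⟩
  obtain ⟨C, hC⟩ := hK.exists_bound_of_continuousOn h1
  refine ⟨C + 1, hK.eventually_forall_of_forall_eventually fun x hx => ?_⟩
  have h2 := (hg (t, x) ⟨ht, mem_univ x⟩).norm.eventually
    (Iio_mem_nhds (show ‖g (t, x)‖ < C + 1 by linarith [hC x hx]))
  filter_upwards [eventually_nhdsWithin_iff.1 h2] with p hp hpI
  exact (hp ⟨hpI, mem_univ _⟩).le

theorem measurableSet_domain : MeasurableSet M.domain := by
  cases M
  · exact measurableSet_Ioc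
  · exact MeasurableSet.univ

/-- Dominated convergence for the difference quotients: on `K` the mean value inequality bounds them
by `C`, and off `K` they vanish. -/
theorem hasDerivWithinAt_integral (hI : I.OrdConnected) (hI' : I.Nontrivial)
    {u : ℝ → Fields M} (hu : IsSmoothFamily I u) {t : ℝ} (ht : t ∈ I) :
    HasDerivWithinAt (fun s => M.integral (u s)) (M.integral (timeDeriv I u t)) I t := by
  obtain ⟨K, hK, hsupp⟩ := hu.exists_compact ht
  obtain ⟨C, hC⟩ := eventually_norm_le_of_continuousOn_strip
    (hu.timeDeriv hI hI').smooth.continuousOn hK ht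
  obtain ⟨δ, hδ, hball⟩ := Metric.eventually_nhds_iff_ball.1 hC
  rw [hasDerivWithinAt_iff_tendsto_slope]
  have hle : 𝓝[I \ {t}] t ≤ 𝓝[I] t := nhdsWithin_mono _ sdiff_subset
  have hslope : slope (fun s => M.integral (u s)) t =
      fun s => ∫ x in M.domain, slope (fun s => (u s : ℝ → ℝ) x) t s := by
    funext s
    simp only [slope_def_module, Base.integral]
    rw [MeasureTheory.integral_smul, MeasureTheory.integral_sub (integrable_fields _)
      (integrable_fields _)]
  rw [hslope]
  refine tendsto_integral_filter_of_dominated_convergence (K.indicator fun _ => C) ?_ ?_ ?_ ?_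
  · refine Eventually.of_forall fun s => ?_
    simp only [slope_def_module]
    exact (((integrable_fields (u s)).sub (integrable_fields (u t))).smul
      (s - t)⁻¹).aestronglyMeasurable
  · filter_upwards [hle hsupp, self_mem_nhdsWithin,
      mem_nhdsWithin_of_mem_nhds (Metric.ball_mem_nhds t hδ)] with s hs hsI hsδ
    refine (ae_restrict_iff' measurableSet_domain).2 (Eventually.of_forall fun x hx => ?_)
    by_cases hxK : x ∈ K
    · rw [indicator_of_mem hxK, slope_def_module, norm_smul, norm_inv]
      -- Convexity of this set lets the mean value inequality run with one-sided derivatives.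
      have hconv : Convex ℝ (I ∩ Metric.ball t δ) := hI.convex.inter (convex_ball t δ)
      have hmv := hconv.norm_image_sub_le_of_norm_hasDerivWithin_le
        (f := fun s => (u s : ℝ → ℝ) x) (f' := fun s => (timeDeriv I u s : ℝ → ℝ) x) (C := C)
        (fun r hr => (hasDerivWithinAt_timeDeriv hI hI' hu hr.1 x).mono inter_subset_left)
        (fun r hr => hball r hr.2 x hxK hr.1) ⟨ht, Metric.mem_ball_self hδ⟩ ⟨hsI.1, hsδ⟩
      have hpos : 0 < ‖s - t‖ := norm_pos_iff.2 (sub_ne_zero.2 hsI.2)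
      rw [inv_mul_le_iff₀ hpos, mul_comm]
      exact hmv
    · rw [indicator_of_notMem hxK, slope_def_module, hs x hx hxK,
        hsupp.self_of_nhdsWithin ht x hx hxK]
      simp
  · exact ((integrable_indicator_iff hK.measurableSet).2
      (integrableOn_const hK.measure_lt_top.ne)).restrict
  · refine Eventually.of_forall fun x => ?_
    exact hasDerivWithinAt_iff_tendsto_slope.1 (hasDerivWithinAt_timeDeriv hI hI' hu ht x)

/-- The derivative is the integral of another smooth family, so induction on the order applies with
the family generalized. -/
theorem contDiffOn_integral (hI : I.OrdConnected) (hI' : I.Nontrivial)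
    {u : ℝ → Fields M} (hu : IsSmoothFamily I u) :
    ContDiffOn ℝ ∞ (fun s => M.integral (u s)) I := by
  have hU := uniqueDiffOn_interval hI hI'
  rw [contDiffOn_infty]
  intro n
  induction n generalizing u with
  | zero =>
    exact contDiffOn_zero.2 fun t ht => (hasDerivWithinAt_integral hI hI' hu ht).continuousWithinAt
  | succ n ih =>
    rw [Nat.cast_succ, contDiffOn_succ_iff_derivWithin hU]
    refine ⟨fun t ht => (hasDerivWithinAt_integral hI hI' hu ht).differentiableWithinAt,
      by simp, ?_⟩
    exact (ih (hu.timeDeriv hI hI')).congr fun t ht =>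
      (hasDerivWithinAt_integral hI hI' hu ht).derivWithin (hU t ht)

/-! ### The inner product and the adjoint of `ad` -/

theorem integral_neg (f : Fields M) : M.integral (-f : Fields M) = -M.integral f := by
  simpa using integral_smul (-1) f

theorem integral_D_mul (f g : Fields M) :
    M.integral (D f * g : Fields M) = -M.integral (f * D g : Fields M) := by
  have h := integral_D (f * g)
  rw [D_mul, integral_add] at h
  linarith

theorem omega_eq_integral_third (h k : Fields M) :
    omega M h k = M.integral (D (D (D h)) * k : Fields M) := by
  rw [omega_eq, integral_D_mul (D (D h)), integral_D_mul (D h), neg_neg]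

/-- Polarization of `omega_self`. -/
theorem omega_antisymm (h k : Fields M) : omega M h k = -omega M k h := by
  have h1 := omega_self (h + k)
  rw [omega_add_left, omega_add_right, omega_add_right, omega_self, omega_self] at h1
  linarith

theorem eq_zero_of_integral_mul_self (f : Fields M) (h : M.integral (f * f : Fields M) = 0) :
    f = 0 := by
  have hae : (f * f : Fields M) =ᵐ[volume.restrict M.domain] (0 : ℝ → ℝ) :=
    (integral_eq_zero_iff_of_nonneg (fun x => mul_self_nonneg ((f : ℝ → ℝ) x))
      (integrable_fields (f * f))).1 h
  have hae' : (f : ℝ → ℝ) =ᵐ[volume.restrict M.domain] (0 : ℝ → ℝ) :=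
    hae.mono fun x hx => mul_self_eq_zero.1 hx
  have hc := f.2.1.continuous
  have ha := f.2.2
  ext x
  cases M
  · have hpos : (0 : ℝ) < 2 * Real.pi := by positivity
    have heq : EqOn (f : ℝ → ℝ) 0 (Ioc 0 (2 * Real.pi)) :=
      Measure.eqOn_Ioc_of_ae_eq volume hae' hc.continuousOn continuousOn_const
    obtain ⟨z, hz, hxz⟩ := Function.Periodic.exists_mem_Ioc ha hpos x 0
    rw [zero_add] at hz
    rw [hxz]
    exact heq hz
  · simp only [Base.domain, Measure.restrict_univ] at hae'
    exact congrFun ((hc.ae_eq_iff_eq volume continuous_const).1 hae') x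

theorem fst_add (X Y : Vir M) : (X + Y).1 = X.1 + Y.1 := rfl
theorem snd_add (X Y : Vir M) : (X + Y).2 = X.2 + Y.2 := rfl
theorem fst_sub (X Y : Vir M) : (X - Y).1 = X.1 - Y.1 := rfl
theorem snd_sub (X Y : Vir M) : (X - Y).2 = X.2 - Y.2 := rfl
theorem fst_neg (X : Vir M) : (-X).1 = -X.1 := rfl
theorem snd_neg (X : Vir M) : (-X).2 = -X.2 := rfl
theorem fst_lie (X Y : Vir M) : ⁅X, Y⁆.1 = D X.1 * Y.1 - X.1 * D Y.1 := rfl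
theorem snd_lie (X Y : Vir M) : ⁅X, Y⁆.2 = omega M X.1 Y.1 := rfl

theorem ip_sub_right (X Y Z : Vir M) : ip X (Y - Z) = ip X Y - ip X Z := by
  have h : X.1 * (Y - Z).1 = X.1 * Y.1 + -(X.1 * Z.1) := by
    rw [fst_sub, mul_sub, sub_eq_add_neg]
  simp only [ip]
  rw [h, snd_sub, integral_add, integral_neg]
  ring

theorem eq_zero_of_ip_self (X : Vir M) (h : ip X X = 0) : X = 0 := by
  have h1 : 0 ≤ M.integral (X.1 * X.1 : Fields M) :=
    integral_nonneg fun x => mul_self_nonneg ((X.1 : ℝ → ℝ) x)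
  have h2 := mul_self_nonneg X.2
  simp only [ip] at h
  exact Prod.ext (eq_zero_of_integral_mul_self _ (by linarith))
    (mul_self_eq_zero.1 (by linarith))

/-- The two integrands differ by the total derivative of the product of the three fields, and ω
contributes X''' Y weighted by the central part of `Z`. -/
theorem ip_lie_left (X Y Z : Vir M) :
    ip ⁅X, Y⁆ Z =
      M.integral (Y.1 * ((2 : ℝ) • (D X.1 * Z.1) + X.1 * D Z.1 + Z.2 • D (D (D X.1))) : Fields M)
      := by
  have h1 : Y.1 * ((2 : ℝ) • (D X.1 * Z.1) + X.1 * D Z.1 + Z.2 • D (D (D X.1))) =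
      (D X.1 * Y.1 - X.1 * D Y.1) * Z.1 + Z.2 • (D (D (D X.1)) * Y.1) + D (X.1 * Y.1 * Z.1) := by
    simp only [D_mul]
    ext x
    simp
    ring
  rw [h1, integral_add, integral_D, add_zero, integral_add, integral_smul,
    ← omega_eq_integral_third, ip, fst_lie, snd_lie, mul_comm Z.2]

/-- The displayed vector satisfies the defining identity, so the choice in `adT` is a genuine
adjoint; the difference of two adjoints is orthogonal to everything, itself included, hence zero.
The central entry is 0 because the bracket ignores the central part of its argument. -/
theorem adT_eq (X Z : Vir M) : adT ip X Z =
    (((2 : ℝ) • (D X.1 * Z.1) + X.1 * D Z.1 + Z.2 • D (D (D X.1)), 0) : Fields M × ℝ) := by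
  set W : Vir M :=
    (((2 : ℝ) • (D X.1 * Z.1) + X.1 * D Z.1 + Z.2 • D (D (D X.1)), 0) : Fields M × ℝ) with hW
  have hspec : ∀ Y, ip ⁅X, Y⁆ Z = ip Y W := by
    intro Y
    rw [ip_lie_left, ip, hW]
    simp
  have h := Classical.epsilon_spec (p := fun W => ∀ Y, ip ⁅X, Y⁆ Z = ip Y W) ⟨W, hspec⟩
  refine sub_eq_zero.1 (eq_zero_of_ip_self _ ?_)
  rw [ip_sub_right, sub_eq_zero]
  exact (h _).symm.trans (hspec _)

theorem fst_adT (X Z : Vir M) :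
    (adT ip X Z).1 = (2 : ℝ) • (D X.1 * Z.1) + X.1 * D Z.1 + Z.2 • D (D (D X.1)) := by
  rw [adT_eq]

theorem snd_adT (X Z : Vir M) : (adT ip X Z).2 = 0 := by
  rw [adT_eq]

/-! ### The Jacobi equation in components -/

/-- The vector field `3 u_x u + a u_xxx`. -/
noncomputable def kdvField (a : ℝ) (u : Fields M) : Fields M :=
  (3 : ℝ) • (D u * u) + a • D (D (D u))

theorem fst_adT_self (X : Vir M) : (adT ip X X).1 = kdvField X.2 X.1 := by
  rw [fst_adT, kdvField]
  ext x
  simp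
  ring

/-- The right hand side of the first component of the Jacobi equation, with `v = y_t`. -/
noncomputable def jacobiField (a B : ℝ) (u y v : Fields M) : Fields M :=
  -(u * ((4 : ℝ) • D v + (3 : ℝ) • (u * D (D y)) + a • D (D (D (D y)))))
    - D u * ((2 : ℝ) • v + (2 * a) • D (D (D y)))
    - (B • D (D (D u)) - (3 * a) • (D (D (D u)) * D y))
    - a • D (D (D v))

/-- The coefficient of u_xxx collects the central parts hit by ad(U)ᵀ: `V.2` from ad(U)ᵀV, and ω(y,
u) from ad(U)ᵀ[Y, U]. The rest is a pointwise identity. -/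
theorem fst_jacobiRHS (U Y V : Vir M) : (jacobiRHS ip U Y V).1 =
    jacobiField U.2 (V.2 + omega M Y.1 U.1) U.1 Y.1 V.1 := by
  simp only [jacobiRHS, al, fst_add, fst_sub, fst_lie, fst_adT, snd_adT, snd_add, snd_lie,
    jacobiField, D_add, D_sub, D_mul, D_smul]
  ext x
  simp
  ring

/-- Adjoints have no central part, so only the brackets [Y, ad(U)ᵀU] and [U, V] contribute. -/
theorem snd_jacobiRHS (U Y V : Vir M) : (jacobiRHS ip U Y V).2 =
    omega M U.1 V.1 + omega M Y.1 (kdvField U.2 U.1) := by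
  simp only [jacobiRHS, al, snd_add, snd_sub, snd_lie, snd_adT, fst_adT_self]
  ring

/-! ### Partial derivatives -/

theorem iteratedDeriv_fields (k : ℕ) (f : Fields M) : iteratedDeriv k (f : ℝ → ℝ) = (D^[k] f) := by
  induction k with
  | zero => simp
  | succ k ih =>
    rw [iteratedDeriv_succ, ih, Function.iterate_succ_apply']
    rfl

theorem dx_fn (k : ℕ) (u : ℝ → Fields M) (t : ℝ) : dx k (fn u) t = (D^[k] (u t)) :=
  iteratedDeriv_fields k (u t)

theorem dx_dt (hI : I.OrdConnected) (hI' : I.Nontrivial) (k : ℕ)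
    {y : ℝ → Fields M} (hy : IsSmoothFamily I y) {t : ℝ} (ht : t ∈ I) :
    dx k (dt I (fn y)) t = (D^[k] (timeDeriv I y t)) := by
  unfold dx
  rw [← timeDeriv_coe hI hI' hy ht]
  exact iteratedDeriv_fields k _

theorem dt_dt (hI : I.OrdConnected) (hI' : I.Nontrivial)
    {y : ℝ → Fields M} (hy : IsSmoothFamily I y) {t : ℝ} (ht : t ∈ I) :
    dt I (dt I (fn y)) t = timeDeriv I (timeDeriv I y) t := by
  rw [timeDeriv_coe hI hI' (hy.timeDeriv hI hI') ht]
  ext x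
  refine derivWithin_congr (fun s hs => ?_) ?_
  · exact (congrFun (timeDeriv_coe hI hI' hy hs) x).symm
  · exact (congrFun (timeDeriv_coe hI hI' hy ht) x).symm

theorem isKdV_iff (hI : I.OrdConnected) (hI' : I.Nontrivial) {u : ℝ → Fields M}
    (hu : IsSmoothFamily I u) (a : ℝ) :
    IsKdV I a (fn u) ↔ ∀ t ∈ I, timeDeriv I u t = -kdvField a (u t) := by
  refine forall₂_congr fun t ht => ?_
  rw [Subtype.ext_iff, funext_iff, timeDeriv_coe hI hI' hu ht]
  refine forall_congr' fun x => Eq.congr_right ?_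
  simp only [dx_fn]
  simp [kdvField, fn]
  ring

theorem jacobiPDE_iff (hI : I.OrdConnected) (hI' : I.Nontrivial) (u : ℝ → Fields M)
    {y : ℝ → Fields M} (hy : IsSmoothFamily I y) (a B : ℝ → ℝ) :
    JacobiPDE I a B (fn u) (fn y) ↔ ∀ t ∈ I, timeDeriv I (timeDeriv I y) t =
      jacobiField (a t) (B t) (u t) (y t) (timeDeriv I y t) := by
  refine forall₂_congr fun t ht => ?_
  rw [Subtype.ext_iff, funext_iff]
  refine forall_congr' fun x => ?_
  rw [dt_dt hI hI' hy ht]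
  refine Eq.congr_right ?_
  simp only [dx_fn, dx_dt hI hI' _ hy ht, ← timeDeriv_coe hI hI' hy ht]
  simp [jacobiField, fn]
  ring

/-- Agreement of `U` with (u, a) is asked only on `I`, so that the lemma can be applied a second
time to a first derivative known only there. -/
theorem isTimeDeriv_iff (hI : I.OrdConnected) (hI' : I.Nontrivial) {U V : ℝ → Vir M}
    {u : ℝ → Fields M} {a : ℝ → ℝ} (hu : IsSmoothFamily I u) (ha : DifferentiableOn ℝ a I)
    (hU : ∀ t ∈ I, (U t).1 = u t ∧ (U t).2 = a t) :
    IsTimeDeriv I U V ↔ ∀ t ∈ I, (V t).1 = timeDeriv I u t ∧ (V t).2 = derivWithin a I t := by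
  have hD := uniqueDiffOn_interval hI hI'
  have h1 : ∀ t ∈ I, ∀ x (f : ℝ), HasDerivWithinAt (fun s => ((U s).1 : ℝ → ℝ) x) f I t ↔
      HasDerivWithinAt (fun s => (u s : ℝ → ℝ) x) f I t := fun t ht x f =>
    ⟨fun h => h.congr (fun s hs => by rw [(hU s hs).1]) (by rw [(hU t ht).1]),
      fun h => h.congr (fun s hs => by rw [(hU s hs).1]) (by rw [(hU t ht).1])⟩
  have h2 : ∀ t ∈ I, ∀ f : ℝ, HasDerivWithinAt (fun s => (U s).2) f I t ↔
      HasDerivWithinAt a f I t := fun t ht f =>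
    ⟨fun h => h.congr (fun s hs => (hU s hs).2.symm) (hU t ht).2.symm,
      fun h => h.congr (fun s hs => (hU s hs).2) (hU t ht).2⟩
  refine forall₂_congr fun t ht => and_congr ?_ ?_
  · simp only [h1 t ht]
    refine ⟨fun h => (timeDeriv_eq_of_hasDerivWithinAt hI hI' ht h).symm, fun h x => ?_⟩
    rw [h]
    exact hasDerivWithinAt_timeDeriv hI hI' hu ht x
  · rw [h2 t ht]
    refine ⟨fun h => (h.derivWithin (hD t ht)).symm, fun h => ?_⟩
    rw [h]
    exact (ha t ht).hasDerivWithinAt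

theorem isGeodesicVelocity_iff (hI : I.OrdConnected) (hI' : I.Nontrivial) {u : ℝ → Fields M}
    (hu : IsSmoothFamily I u) {a : ℝ → ℝ} (ha : DifferentiableOn ℝ a I) :
    IsGeodesicVelocity I (curve u a) ↔
      ∀ t ∈ I, timeDeriv I u t = -kdvField (a t) (u t) ∧ derivWithin a I t = 0 := by
  have hrhs : ∀ t, -adT ip (curve u a t) (curve u a t) = ((-kdvField (a t) (u t), 0) :
      Fields M × ℝ) := fun t => Prod.ext (by rw [fst_neg, fst_adT_self]; rfl)
    (by rw [snd_neg, snd_adT, neg_zero])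
  constructor
  · rintro ⟨V, hV, hVU⟩ t ht
    obtain ⟨h1, h2⟩ := (isTimeDeriv_iff hI hI' hu ha fun _ _ => ⟨rfl, rfl⟩).1 hV t ht
    rw [← h1, ← h2, hVU t ht, hrhs]
    exact ⟨rfl, rfl⟩
  · intro h
    refine ⟨curve (timeDeriv I u) (derivWithin a I),
      (isTimeDeriv_iff hI hI' hu ha fun _ _ => ⟨rfl, rfl⟩).2 fun _ _ => ⟨rfl, rfl⟩, fun t ht => ?_⟩
    rw [hrhs]
    exact Prod.ext (h t ht).1 (h t ht).2

theorem isGeodesicVelocity_iff_isKdV (hI : I.OrdConnected) (hI' : I.Nontrivial)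
    {u : ℝ → Fields M} (hu : IsSmoothFamily I u) {a : ℝ → ℝ} (ha : DifferentiableOn ℝ a I) :
    IsGeodesicVelocity I (curve u a) ↔ ∃ a₀ : ℝ, (∀ t ∈ I, a t = a₀) ∧ IsKdV I a₀ (fn u) := by
  rw [isGeodesicVelocity_iff hI hI' hu ha]
  constructor
  · intro h
    obtain ⟨t₀, ht₀⟩ := hI'.nonempty
    have hc : ∀ t ∈ I, a t = a t₀ := fun t ht =>
      eq_of_hasDerivWithinAt_zero hI (fun s hs => (h s hs).2 ▸ (ha s hs).hasDerivWithinAt) ht ht₀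
    refine ⟨a t₀, hc, (isKdV_iff hI hI' hu _).2 fun t ht => ?_⟩
    rw [← hc t ht]
    exact (h t ht).1
  · rintro ⟨a₀, hc, hk⟩ t ht
    refine ⟨?_, ?_⟩
    · rw [hc t ht]
      exact (isKdV_iff hI hI' hu _).1 hk t ht
    · rw [derivWithin_congr hc (hc t ht)]
      simp

theorem isJacobiField_iff (hI : I.OrdConnected) (hI' : I.Nontrivial) {u y : ℝ → Fields M}
    (hy : IsSmoothFamily I y) {a b : ℝ → ℝ} (hb : DifferentiableOn ℝ b I)
    (hb' : DifferentiableOn ℝ (derivWithin b I) I) :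
    IsJacobiField I (curve u a) (curve y b) ↔
      JacobiPDE I a (fun t => derivWithin b I t + omega M (y t) (u t)) (fn u) (fn y) ∧
        ∀ t ∈ I, derivWithin (derivWithin b I) I t =
          omega M (u t) (timeDeriv I y t) + omega M (y t) (kdvField (a t) (u t)) := by
  rw [jacobiPDE_iff hI hI' u hy, ← forall₂_and]
  constructor
  · rintro ⟨V, W, hV, hW, hJ⟩ t ht
    have h1 := (isTimeDeriv_iff hI hI' hy hb fun _ _ => ⟨rfl, rfl⟩).1 hV
    obtain ⟨h2, h3⟩ := (isTimeDeriv_iff hI hI' (hy.timeDeriv hI hI') hb' h1).1 hW t ht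
    rw [← h2, ← h3, hJ t ht, fst_jacobiRHS, snd_jacobiRHS, ← (h1 t ht).1, ← (h1 t ht).2]
    exact ⟨rfl, rfl⟩
  · intro h
    refine ⟨curve (timeDeriv I y) (derivWithin b I),
      curve (timeDeriv I (timeDeriv I y)) (derivWithin (derivWithin b I) I),
      (isTimeDeriv_iff hI hI' hy hb fun _ _ => ⟨rfl, rfl⟩).2 fun _ _ => ⟨rfl, rfl⟩,
      (isTimeDeriv_iff hI hI' (hy.timeDeriv hI hI') hb' fun _ _ => ⟨rfl, rfl⟩).2
        fun _ _ => ⟨rfl, rfl⟩, fun t ht => Prod.ext ?_ ?_⟩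
    · rw [fst_jacobiRHS]
      exact (h t ht).1
    · rw [snd_jacobiRHS]
      exact (h t ht).2

/-! ### The conserved quantity -/

theorem integral_dx_three_mul (u y : ℝ → Fields M) (t : ℝ) :
    M.integral (fun x => dx 3 (fn y) t x * fn u t x) = omega M (y t) (u t) := by
  rw [omega_eq_integral_third, dx_fn]
  rfl

theorem isSmoothFamily_omega_integrand (hI : I.OrdConnected) (hI' : I.Nontrivial)
    {u y : ℝ → Fields M} (hu : IsSmoothFamily I u) (hy : IsSmoothFamily I y) :
    IsSmoothFamily I fun t => D (y t) * D (D (u t)) :=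
  (hy.D hI hI').mul ((hu.D hI hI').D hI hI')

theorem contDiffOn_omega (hI : I.OrdConnected) (hI' : I.Nontrivial)
    {u y : ℝ → Fields M} (hu : IsSmoothFamily I u) (hy : IsSmoothFamily I y) :
    ContDiffOn ℝ ∞ (fun t => omega M (y t) (u t)) I := by
  simp only [omega_eq]
  exact contDiffOn_integral hI hI' (isSmoothFamily_omega_integrand hI hI' hu hy)

theorem hasDerivWithinAt_omega (hI : I.OrdConnected) (hI' : I.Nontrivial)
    {u y : ℝ → Fields M} (hu : IsSmoothFamily I u) (hy : IsSmoothFamily I y) {t : ℝ}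
    (ht : t ∈ I) : HasDerivWithinAt (fun s => omega M (y s) (u s))
      (omega M (timeDeriv I y t) (u t) + omega M (y t) (timeDeriv I u t)) I t := by
  have h := hasDerivWithinAt_integral hI hI' (isSmoothFamily_omega_integrand hI hI' hu hy) ht
  rw [timeDeriv_mul hI hI' (hy.D hI hI') ((hu.D hI hI').D hI hI') ht, timeDeriv_D hI hI' hy ht,
    timeDeriv_D hI hI' (hu.D hI hI') ht, timeDeriv_D hI hI' hu ht, integral_add] at h
  simpa only [omega_eq] using h

/-- Along a solution of the geodesic equation, the derivative of `ω(y, u)` is the negative of the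
right hand side of the second component of the Jacobi equation. -/
theorem hasDerivWithinAt_omega_of_kdv (hI : I.OrdConnected) (hI' : I.Nontrivial)
    {u y : ℝ → Fields M} (hu : IsSmoothFamily I u) (hy : IsSmoothFamily I y) {a t : ℝ}
    (ht : t ∈ I) (hk : timeDeriv I u t = -kdvField a (u t)) :
    HasDerivWithinAt (fun s => omega M (y s) (u s))
      (-(omega M (u t) (timeDeriv I y t) + omega M (y t) (kdvField a (u t)))) I t := by
  have h := hasDerivWithinAt_omega hI hI' hu hy ht
  rwa [hk, omega_antisymm (timeDeriv I y t), ← neg_one_smul ℝ (kdvField a (u t)),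
    omega_smul_right, neg_one_mul, ← neg_add] at h

theorem omega_kdvField (u : ℝ → Fields M) (y : Fields M) (a t : ℝ) :
    omega M y (kdvField a (u t)) = omega M y (fun x => 3 * dx 1 (fn u) t x * fn u t x)
      + omega M y (fun x => a * dx 3 (fn u) t x) := by
  have h1 : (fun x => 3 * dx 1 (fn u) t x * fn u t x) = ((3 : ℝ) • (D (u t) * u t) : Fields M) := by
    rw [dx_fn]
    ext x
    simp [fn]
    ring
  have h2 : (fun x => a * dx 3 (fn u) t x) = (a • D (D (D (u t))) : Fields M) := by
    rw [dx_fn]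
    rfl
  rw [kdvField, omega_add_right, h1, h2]

theorem integral_second_component (hI : I.OrdConnected) (hI' : I.Nontrivial)
    (u : ℝ → Fields M) {y : ℝ → Fields M} (hy : IsSmoothFamily I y) (a : ℝ) {t : ℝ} (ht : t ∈ I) :
    (M.integral fun x => - dx 3 (dt I (fn y)) t x * fn u t x
      + dx 3 (fn y) t x * (3 * dx 1 (fn u) t x * fn u t x + a * dx 3 (fn u) t x)) =
      omega M (u t) (timeDeriv I y t) + omega M (y t) (kdvField a (u t)) := by
  rw [omega_antisymm, omega_eq_integral_third, omega_eq_integral_third, ← integral_neg,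
    ← integral_add, dx_dt hI hI' 3 hy ht, dx_fn, dx_fn, dx_fn]
  congr 1
  ext x
  -- The excluded lemmas would cancel common factors and leave a disjunction, out of reach of
  -- `ring`.
  simp [kdvField, fn, -mul_eq_mul_left_iff, -mul_eq_mul_right_iff]
  ring

theorem derivWithin_add_omega_const (hI : I.OrdConnected) (hI' : I.Nontrivial)
    {u y : ℝ → Fields M} (hu : IsSmoothFamily I u) (hy : IsSmoothFamily I y) {a b : ℝ → ℝ}
    (hb' : DifferentiableOn ℝ (derivWithin b I) I)
    (hk : ∀ t ∈ I, timeDeriv I u t = -kdvField (a t) (u t))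
    (h2 : ∀ t ∈ I, derivWithin (derivWithin b I) I t =
      omega M (u t) (timeDeriv I y t) + omega M (y t) (kdvField (a t) (u t))) :
    ∃ B₁, ∀ t ∈ I, derivWithin b I t + omega M (y t) (u t) = B₁ := by
  obtain ⟨t₀, ht₀⟩ := hI'.nonempty
  refine ⟨_, fun t ht => eq_of_hasDerivWithinAt_zero hI
    (f := fun t => derivWithin b I t + omega M (y t) (u t)) (fun s hs => ?_) ht ht₀⟩
  have h := (hb' s hs).hasDerivWithinAt.add
    (hasDerivWithinAt_omega_of_kdv hI hI' hu hy hs (hk s hs))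
  rwa [h2 s hs, add_neg_cancel] at h

/-- Differentiating b_t = B₁ - ω(y, u) along KdV gives the central equation back; no equation for
`y` enters. -/
theorem derivWithin_derivWithin_of_conserved (hI : I.OrdConnected) (hI' : I.Nontrivial)
    {u y : ℝ → Fields M} (hu : IsSmoothFamily I u) (hy : IsSmoothFamily I y) {a b : ℝ → ℝ}
    (hk : ∀ t ∈ I, timeDeriv I u t = -kdvField (a t) (u t)) {B₁ : ℝ}
    (hB : ∀ t ∈ I, derivWithin b I t + omega M (y t) (u t) = B₁) {t : ℝ} (ht : t ∈ I) :
    derivWithin (derivWithin b I) I t =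
      omega M (u t) (timeDeriv I y t) + omega M (y t) (kdvField (a t) (u t)) := by
  have h := (hasDerivWithinAt_omega_of_kdv hI hI' hu hy ht (hk t ht)).const_sub B₁
  rw [neg_neg] at h
  have hc : ∀ s ∈ I, derivWithin b I s = B₁ - omega M (y s) (u s) := fun s hs =>
    eq_sub_of_add_eq (hB s hs)
  exact (h.congr hc (hc t ht)).derivWithin (uniqueDiffOn_interval hI hI' t ht)

/-! ### The reduced system and the explicit formula for the central component -/

theorem jacobiPDE_congr {a a' B B' : ℝ → ℝ} (ha : ∀ t ∈ I, a t = a' t) (hB : ∀ t ∈ I, B t = B' t)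
    (u y : ℝ → ℝ → ℝ) : JacobiPDE I a B u y ↔ JacobiPDE I a' B' u y :=
  forall₂_congr fun t ht => by rw [ha t ht, hB t ht]

theorem differentiableOn_derivWithin (hI : I.OrdConnected) (hI' : I.Nontrivial) {b : ℝ → ℝ}
    (hb : ContDiffOn ℝ ∞ b I) : DifferentiableOn ℝ (derivWithin b I) I :=
  (hb.derivWithin (m := 1) (uniqueDiffOn_interval hI hI')
    (WithTop.coe_le_coe.2 le_top)).differentiableOn (by simp)

/-- The conserved quantity is the coefficient of u_xxx in the field component, so its constancy both
replaces the central equation and decouples `y` from `b`. -/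
theorem geodesic_and_jacobi_iff (hI : I.OrdConnected) (hI' : I.Nontrivial)
    {u y : ℝ → Fields M} (hu : IsSmoothFamily I u) (hy : IsSmoothFamily I y) {a b : ℝ → ℝ}
    (ha : ContDiffOn ℝ ∞ a I) (hb : ContDiffOn ℝ ∞ b I) :
    IsGeodesicVelocity I (curve u a) ∧ IsJacobiField I (curve u a) (curve y b) ↔
      ∃ a₀ B₁ : ℝ, (∀ t ∈ I, a t = a₀) ∧ IsKdV I a₀ (fn u) ∧
        JacobiPDE I (fun _ => a₀) (fun _ => B₁) (fn u) (fn y) ∧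
        ∀ t ∈ I, derivWithin b I t + omega M (y t) (u t) = B₁ := by
  have hb' := differentiableOn_derivWithin hI hI' hb
  have ha₁ := ha.differentiableOn (by simp)
  rw [isJacobiField_iff hI hI' hy (hb.differentiableOn (by simp)) hb']
  constructor
  · rintro ⟨hg, hP, h2⟩
    have hk := fun t ht => ((isGeodesicVelocity_iff hI hI' hu ha₁).1 hg t ht).1
    obtain ⟨a₀, hc, hkdv⟩ := (isGeodesicVelocity_iff_isKdV hI hI' hu ha₁).1 hg
    obtain ⟨B₁, hB⟩ := derivWithin_add_omega_const hI hI' hu hy hb' hk h2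
    exact ⟨a₀, B₁, hc, hkdv, (jacobiPDE_congr hc hB _ _).1 hP, hB⟩
  · rintro ⟨a₀, B₁, hc, hkdv, hP, hB⟩
    have hg := (isGeodesicVelocity_iff_isKdV hI hI' hu ha₁).2 ⟨a₀, hc, hkdv⟩
    have hk := fun t ht => ((isGeodesicVelocity_iff hI hI' hu ha₁).1 hg t ht).1
    exact ⟨hg, (jacobiPDE_congr hc hB _ _).2 hP, fun t ht =>
      derivWithin_derivWithin_of_conserved hI hI' hu hy hk hB ht⟩

theorem eq_integral_of_conserved (hI : I.OrdConnected) {b F : ℝ → ℝ}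
    (hb : DifferentiableOn ℝ b I) (hF : ContinuousOn F I) {B₁ : ℝ}
    (hB : ∀ t ∈ I, derivWithin b I t + F t = B₁) {t₀ : ℝ} (ht₀ : t₀ ∈ I) :
    ∃ B₀ : ℝ, ∀ t ∈ I, b t = B₀ + B₁ * t - ∫ s in t₀..t, F s := by
  -- The linear term is B₁ t, not B₁ (t - t₀), hence the shift by B₁ t₀; the integral is zero, kept
  -- to match the value at t₀ of the constant function below.
  refine ⟨b t₀ + (∫ s in t₀..t₀, F s) - B₁ * t₀, fun t ht => ?_⟩
  have h := eq_of_hasDerivWithinAt_zero hI (f := fun t => b t + (∫ s in t₀..t, F s) - B₁ * t)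
    (fun s hs => ?_) ht ht₀
  · linarith
  · have h1 := ((hb s hs).hasDerivWithinAt.add
      (hasDerivWithinAt_integral_of_continuousOn hI hF ht₀ hs)).sub
      ((hasDerivWithinAt_id s I).const_mul B₁)
    rwa [hB s hs, mul_one, sub_self] at h1

/-- By the fundamental theorem the derivative of `b` is B₁ - F, which is smooth; hence so is `b`. -/
theorem contDiffOn_of_eq_integral (hI : I.OrdConnected) (hI' : I.Nontrivial) {b F : ℝ → ℝ}
    (hF : ContDiffOn ℝ ∞ F I) {B₀ B₁ t₀ : ℝ} (ht₀ : t₀ ∈ I)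
    (hb : ∀ t ∈ I, b t = B₀ + B₁ * t - ∫ s in t₀..t, F s) :
    ContDiffOn ℝ ∞ b I ∧ ∀ t ∈ I, derivWithin b I t + F t = B₁ := by
  have hU := uniqueDiffOn_interval hI hI'
  have hd : ∀ t ∈ I, HasDerivWithinAt b (B₁ - F t) I t := fun t ht => by
    have h := (((hasDerivWithinAt_id t I).const_mul B₁).const_add B₀).sub
      (hasDerivWithinAt_integral_of_continuousOn hI hF.continuousOn ht₀ ht)
    rw [mul_one] at h
    exact h.congr hb (hb t ht)
  have hd' : ∀ t ∈ I, derivWithin b I t = B₁ - F t := fun t ht => (hd t ht).derivWithin (hU t ht)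
  refine ⟨?_, fun t ht => by rw [hd' t ht]; ring⟩
  rw [contDiffOn_infty_iff_derivWithin hU]
  exact ⟨fun t ht => (hd t ht).differentiableWithinAt, (contDiffOn_const.sub hF).congr hd'⟩

end VirasoroBott

open VirasoroBott in
theorem mainTheorem7 (M : Base) (I : Set ℝ) (hI : I.OrdConnected) (hI' : I.Nontrivial)
    (u y : ℝ → Fields M) (hu : IsSmoothFamily I u) (hy : IsSmoothFamily I y) :
    -- the geodesic equation
    (∀ a : ℝ → ℝ, ContDiffOn ℝ ∞ a I →
      (IsGeodesicVelocity I (curve u a) ↔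
        ∃ a₀ : ℝ, (∀ t ∈ I, a t = a₀) ∧ IsKdV I a₀ (fn u))) ∧
    -- Jacobi fields along a geodesic
    (∀ a b : ℝ → ℝ, ContDiffOn ℝ ∞ a I → ContDiffOn ℝ ∞ b I →
      IsGeodesicVelocity I (curve u a) →
      -- the Jacobi equation in components
      (IsJacobiField I (curve u a) (curve y b) ↔
        JacobiPDE I a (fun t => derivWithin b I t + omega M (y t) (u t)) (fn u) (fn y) ∧
        ∀ t ∈ I, derivWithin (derivWithin b I) I t =
          omega M (u t) (dt I (fn y) t)
          + omega M (y t) (fun x => 3 * dx 1 (fn u) t x * fn u t x)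
          + omega M (y t) (fun x => a t * dx 3 (fn u) t x)) ∧
      -- the second form of the second component
      (∀ t ∈ I,
        (derivWithin (derivWithin b I) I t =
          omega M (u t) (dt I (fn y) t)
          + omega M (y t) (fun x => 3 * dx 1 (fn u) t x * fn u t x)
          + omega M (y t) (fun x => a t * dx 3 (fn u) t x)) ↔
        derivWithin (derivWithin b I) I t =
          M.integral fun x => - dx 3 (dt I (fn y)) t x * fn u t x
            + dx 3 (fn y) t x * (3 * dx 1 (fn u) t x * fn u t x + a t * dx 3 (fn u) t x)) ∧
      -- the conserved quantity, the formula for `b`, and the reduced equation for `y`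
      (IsJacobiField I (curve u a) (curve y b) → ∃ B₁ : ℝ,
        (∀ t ∈ I, derivWithin b I t + omega M (y t) (u t) = B₁) ∧
        (∀ t ∈ I, derivWithin b I t + M.integral (fun x => dx 3 (fn y) t x * fn u t x) = B₁) ∧
        (∀ t₀ ∈ I, ∃ B₀ : ℝ, ∀ t ∈ I, b t =
          B₀ + B₁ * t - ∫ s in t₀..t, M.integral (fun x => dx 3 (fn y) s x * fn u s x)) ∧
        JacobiPDE I a (fun _ => B₁) (fn u) (fn y))) ∧
    -- the geodesic and Jacobi equations are equivalent to the reduced system together with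
    -- the first order equation for `b`
    (∀ a b : ℝ → ℝ, ContDiffOn ℝ ∞ a I → ContDiffOn ℝ ∞ b I →
      (IsGeodesicVelocity I (curve u a) ∧ IsJacobiField I (curve u a) (curve y b) ↔
        ∃ a₀ B₁ : ℝ, (∀ t ∈ I, a t = a₀) ∧ IsKdV I a₀ (fn u) ∧
          JacobiPDE I (fun _ => a₀) (fun _ => B₁) (fn u) (fn y) ∧
          ∀ t ∈ I, derivWithin b I t
            + M.integral (fun x => dx 3 (fn y) t x * fn u t x) = B₁)) ∧
    -- every solution of the reduced system gives a Jacobi field, with `b` given explicitly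
    (∀ a B₀ B₁ : ℝ, ∀ t₀ ∈ I, ∀ b : ℝ → ℝ,
      (∀ t ∈ I, b t =
        B₀ + B₁ * t - ∫ s in t₀..t, M.integral (fun x => dx 3 (fn y) s x * fn u s x)) →
      IsKdV I a (fn u) → JacobiPDE I (fun _ => a) (fun _ => B₁) (fn u) (fn y) →
      ContDiffOn ℝ ∞ b I ∧ IsGeodesicVelocity I (curve u fun _ => a) ∧
        IsJacobiField I (curve u fun _ => a) (curve y b)) := by
  have hder := fun {b : ℝ → ℝ} (hb : ContDiffOn ℝ ∞ b I) =>
    And.intro (hb.differentiableOn (by simp)) (differentiableOn_derivWithin hI hI' hb)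
  have hrhs : ∀ (a : ℝ) (t : ℝ), t ∈ I → omega M (u t) (dt I (fn y) t)
      + omega M (y t) (fun x => 3 * dx 1 (fn u) t x * fn u t x)
      + omega M (y t) (fun x => a * dx 3 (fn u) t x) =
      omega M (u t) (timeDeriv I y t) + omega M (y t) (kdvField a (u t)) := fun a t ht => by
    rw [omega_kdvField, timeDeriv_coe hI hI' hy ht, add_assoc]
  have hF := contDiffOn_omega hI hI' hu hy
  -- Every ∫ y_xxx u becomes ω(y, u), so the two forms of the conservation law coincide.
  simp only [integral_dx_three_mul]
  refine ⟨fun a ha => isGeodesicVelocity_iff_isKdV hI hI' hu (hder ha).1,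
    fun a b ha hb hg => ⟨?_, ?_, ?_⟩,
    fun a b ha hb => geodesic_and_jacobi_iff hI hI' hu hy ha hb, ?_⟩
  · rw [isJacobiField_iff hI hI' hy (hder hb).1 (hder hb).2]
    refine and_congr_right fun _ => forall₂_congr fun t ht => ?_
    rw [hrhs (a t) t ht]
  · intro t ht
    rw [hrhs (a t) t ht, integral_second_component hI hI' u hy (a t) ht]
  · intro hJ
    obtain ⟨a₀, B₁, hc, -, hP, hB⟩ := (geodesic_and_jacobi_iff hI hI' hu hy ha hb).1 ⟨hg, hJ⟩
    exact ⟨B₁, hB, hB, fun t₀ ht₀ =>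
      eq_integral_of_conserved hI (hder hb).1 hF.continuousOn hB ht₀,
      (jacobiPDE_congr hc (fun _ _ => rfl) _ _).2 hP⟩
  · intro a B₀ B₁ t₀ ht₀ b hb hk hP
    obtain ⟨hbs, hB⟩ := contDiffOn_of_eq_integral hI hI' hF ht₀ hb
    exact ⟨hbs, (geodesic_and_jacobi_iff hI hI' hu hy contDiffOn_const hbs).2
      ⟨a, B₁, fun _ _ => rfl, hk, hP, hB⟩⟩
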